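/- Let $0<q<1$ and write $(a;q)_\infty=\prod_{n\ge 0}(1-aq^n)$ and $(a_1,\dots,a_k;q)_\infty=\prod_{j=1}^k (a_j;q)_\infty$. Let $a,b,c,d\in\mathbb C$ satisfy $|abcd/q^3|<1$. (i) Let $\alpha\in\mathbb C\setminus\{0\}$ be such that $\arg\alpha^2$ is not an integer multiple of $2\pi$ (that is, $\alpha^2$ is not a positive real number), and let $p:\mathbb R\to\mathbb C$ be periodic with period $1$ and Lebesgue integrable on $[0,1]$. Then the integrand on the left below is integrable on $\mathbb R$, and $$\int_{-\infty}^{\infty}\frac{(\alpha aq^{x},aq^{-x}/\alpha,\alpha bq^{x},bq^{-x}/\alpha,\alpha cq^{x},cq^{-x}/\alpha,\alpha dq^{x},dq^{-x}/\alpha;q)_\infty}{(\alpha^2q^{2x+1},q^{1-2x}/\alpha^2;q)_\infty}\,p(x)\,dx=\frac{(q,ab/q,ac/q,ad/q,bc/q,bd/q,cd/q;q)_\infty}{(abcd/q^3;q)_\infty}\int_0^1p(x)\,dx .$$ (ii) In particular (case $\alpha=i$, $p\equiv1$, $q^x=e^u$), with $h(x;a)=\prod_{n\ge0}(1-2axq^n+a^2q^{2n})$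 and $h(x;a_1,\dots,a_k)=\prod_{j=1}^k h(x;a_j)$, Askey's integral holds: the integrand on the left below is integrable on $\mathbb R$, and $$\int_{-\infty}^{\infty}\frac{h(i\sinh u;a,b,c,d)}{h(i\sinh u;q^{1/2},-q^{1/2},q,-q)}\,du=(\log q^{-1})\,\frac{(q,ab/q,ac/q,ad/q,bc/q,bd/q,cd/q;q)_\infty}{(abcd/q^3;q)_\infty}.$$ -/

import Mathlib

open MeasureTheory

noncomputable section

/-- The infinite `q`-shifted factorial `(a; q)_∞ = ∏_{n ≥ 0} (1 - a q ^ n)`; the product converges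
absolutely whenever `‖q‖ < 1`. -/
def qPoch (a q : ℂ) : ℂ := ∏' n : ℕ, (1 - a * q ^ n)

/-- The contracted notation `(a₁, …, aₖ; q)_∞ = ∏ⱼ (aⱼ; q)_∞`. -/
def qPochs (l : List ℂ) (q : ℂ) : ℂ := (l.map fun a => qPoch a q).prod

/-- The integrand of the bilateral integral, without the periodic factor:
`(αa q^x, a q^{-x}/α, …, αd q^x, d q^{-x}/α; q)_∞ / (α² q^{2x+1}, q^{1-2x}/α²; q)_∞`. -/
def baileyKernel (q : ℝ) (α a b c d : ℂ) (x : ℝ) : ℂ :=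
  qPochs
      [α * a * (q ^ x : ℝ), a * (q ^ (-x) : ℝ) / α,
       α * b * (q ^ x : ℝ), b * (q ^ (-x) : ℝ) / α,
       α * c * (q ^ x : ℝ), c * (q ^ (-x) : ℝ) / α,
       α * d * (q ^ x : ℝ), d * (q ^ (-x) : ℝ) / α] q /
    qPochs [α ^ 2 * (q ^ (2 * x + 1) : ℝ), (q ^ (1 - 2 * x) : ℝ) / α ^ 2] q

/-- The closed form
`(q, ab/q, ac/q, ad/q, bc/q, bd/q, cd/q; q)_∞ / (abcd/q³; q)_∞`. -/
def baileyValue (q : ℝ) (a b c d : ℂ) : ℂ :=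
  qPochs [(q : ℂ), a * b / q, a * c / q, a * d / q, b * c / q, b * d / q, c * d / q] q /
    qPoch (a * b * c * d / (q : ℂ) ^ 3) q

/-- `h(x; a) = ∏_{n ≥ 0} (1 - 2 a x q ^ n + a² q ^ (2 n))` in base `q`. -/
def askeyH (q x a : ℂ) : ℂ := ∏' n : ℕ, (1 - 2 * a * x * q ^ n + a ^ 2 * q ^ (2 * n))

/-- `h(x; a₁, …, aₖ) = ∏ⱼ h(x; aⱼ)`. -/
def askeyHs (q x : ℂ) (l : List ℂ) : ℂ := (l.map fun a => askeyH q x a).prod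

end

/-! Put z = αq^x. The kernel becomes `wpTerm` at z, and x ↦ x + n becomes z ↦ zq^n. Cutting ℝ into
unit intervals (`integral_mul_periodic_of_tsum`) turns the integral into that of p(x) ∑_n
`wpTerm`(zq^n) over [0,1]. So it suffices that this bilateral sum equals the closed form for every z
with z² ∉ q^ℤ; this is Bailey's ₆ψ₆ summation, `tsum_wpTerm`.

The sum is evaluated by a first-order recurrence in a. A suitable combination of the summands for a
and aq is a difference G(qz) - G(z) with G = `wpCert` (`wpTerm_recurrence`), so it telescopes to
zero over ℤ. Iterating a → aq^N → 0 under dominated convergence extracts the products containing a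
(`tsum_wpTerm_reduce`). Symmetry in a, b, c, d then reduces everything to the sum with all
parameters zero, and that constant is read off from a choice of parameters for which only the term n
= 0 survives (`tsum_wpTerm_terminating`).

Askey's integral is the case α = i, p = 1 after a dilation of the variable. -/

open Filter Topology

/-! ### Infinite q-shifted factorials and the modified theta function. -/

section qPochBasics

variable {q : ℂ}

lemma summable_norm_mul_pow (hq : ‖q‖ < 1) (a : ℂ) : Summable fun n : ℕ => ‖-(a * q ^ n)‖ := by
  simpa using (summable_geometric_of_lt_one (norm_nonneg q) hq).mul_left ‖a‖

lemma multipliable_one_sub_mul_pow (hq : ‖q‖ < 1) (a : ℂ) :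
    Multipliable fun n : ℕ => 1 - a * q ^ n := by
  simpa only [sub_eq_add_neg] using multipliable_one_add_of_summable (summable_norm_mul_pow hq a)

lemma qPoch_step (hq : ‖q‖ < 1) (a : ℂ) : qPoch a q = (1 - a) * qPoch (a * q) q := by
  have h := (multipliable_one_sub_mul_pow hq (a * q))
  have h' : (fun n : ℕ => 1 - a * q * q ^ n) = fun n : ℕ => 1 - a * q ^ (n + 1) := by
    ext n; ring
  rw [h'] at h
  have := tprod_eq_zero_mul' (f := fun n : ℕ => 1 - a * q ^ n) h
  rwa [pow_zero, mul_one, ← h'] at this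

@[simp]
lemma qPoch_zero : qPoch 0 q = 1 := by simp [qPoch]

lemma qPoch_eq_zero_of_mul_pow {a : ℂ} (n : ℕ) (h : a * q ^ n = 1) : qPoch a q = 0 :=
  tprod_of_exists_eq_zero ⟨n, by simp [h]⟩

lemma qPoch_ne_zero (hq : ‖q‖ < 1) {a : ℂ} (h : ∀ n : ℕ, a * q ^ n ≠ 1) : qPoch a q ≠ 0 := by
  have := tprod_one_add_ne_zero_of_summable (f := fun n : ℕ => -(a * q ^ n))
    (fun n => by rw [← sub_eq_add_neg, sub_ne_zero]; exact (h n).symm) (summable_norm_mul_pow hq a)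
  simpa only [← sub_eq_add_neg, qPoch] using this

lemma qPoch_ne_zero_of_norm_lt_one (hq : ‖q‖ < 1) {a : ℂ} (ha : ‖a‖ < 1) : qPoch a q ≠ 0 := by
  refine qPoch_ne_zero hq fun n h => ?_
  have h1 : ‖a * q ^ n‖ < 1 := by
    rw [norm_mul, norm_pow]
    exact mul_lt_one_of_nonneg_of_lt_one_left (norm_nonneg _) ha
      (pow_le_one₀ (norm_nonneg _) hq.le)
  rw [h, norm_one] at h1
  exact lt_irrefl _ h1

lemma continuous_qPoch (hq : ‖q‖ < 1) : Continuous fun a : ℂ => qPoch a q := by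
  rw [continuous_iff_continuousAt]
  intro a
  have hK : IsOpen (Metric.ball (0 : ℂ) (‖a‖ + 1)) := Metric.isOpen_ball
  have h := Summable.hasProdLocallyUniformlyOn_nat_one_add (f := fun (n : ℕ) (x : ℂ) => -(x * q ^ n))
    (u := fun n => (‖a‖ + 1) * ‖q‖ ^ n) hK
    ((summable_geometric_of_lt_one (norm_nonneg q) hq).mul_left _)
    (Eventually.of_forall fun n x hx => by
      rw [norm_neg, norm_mul, norm_pow]
      gcongr
      exact (mem_ball_zero_iff.mp hx).le)
    (fun n => by fun_prop)
  have hc := h.continuousOn (Frequently.of_forall fun s => by fun_prop)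
  have := hc.continuousAt (hK.mem_nhds (x := a) (by simp))
  simpa only [qPoch, sub_eq_add_neg] using this

lemma norm_qPoch_le (hq : ‖q‖ < 1) (a : ℂ) : ‖qPoch a q‖ ≤ Real.exp (‖a‖ / (1 - ‖q‖)) := by
  have hlim := ((multipliable_one_sub_mul_pow hq a).hasProd.tendsto_prod_nat).norm
  refine le_of_tendsto' hlim fun n => ?_
  -- |∏(1 + x_k) - 1| ≤ exp(∑|x_k|) - 1, and the sum is at most a geometric series.
  have h := Finset.norm_prod_one_add_sub_one_le (Finset.range n) fun k => -(a * q ^ k)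
  simp only [← sub_eq_add_neg] at h
  have hsum : ∑ k ∈ Finset.range n, ‖-(a * q ^ k)‖ ≤ ‖a‖ / (1 - ‖q‖) := by
    refine ((summable_norm_mul_pow hq a).sum_le_tsum _ fun _ _ => norm_nonneg _).trans_eq ?_
    simp only [norm_neg, norm_mul, norm_pow]
    rw [tsum_mul_left, tsum_geometric_of_lt_one (norm_nonneg _) hq, div_eq_mul_inv]
  have h3 := norm_le_norm_sub_add (∏ k ∈ Finset.range n, (1 - a * q ^ k)) 1
  have h4 := Real.exp_le_exp.mpr hsum
  rw [norm_one] at h3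
  linarith

lemma norm_qPoch_le_of_le (hq : ‖q‖ < 1) {a : ℂ} {t : ℝ} (h : ‖a‖ ≤ t) :
    ‖qPoch a q‖ ≤ Real.exp (t / (1 - ‖q‖)) := by
  refine (norm_qPoch_le hq a).trans ?_
  have : 0 < 1 - ‖q‖ := by linarith
  gcongr

lemma tendsto_finset_prod_qPoch (hq : ‖q‖ < 1) (a : ℂ) :
    Tendsto (fun N : ℕ => ∏ k ∈ Finset.range N, (1 - a * q ^ k)) atTop (𝓝 (qPoch a q)) :=
  (multipliable_one_sub_mul_pow hq a).hasProd.tendsto_prod_nat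

/-- The modified theta function `θ(x; q) = (x, q/x; q)_∞`. -/
noncomputable def modTheta (q x : ℂ) : ℂ := qPoch x q * qPoch (q / x) q

lemma modTheta_eq (hq : ‖q‖ < 1) (x : ℂ) :
    modTheta q x = (1 - x) * (qPoch (q * x) q * qPoch (q / x) q) := by
  rw [modTheta, qPoch_step hq x, mul_comm x q, mul_assoc]

/-- The shift is by q² because the theta function is evaluated at z², and z ↦ qz multiplies z² by
q². Two factors are peeled off each of the two products. -/
lemma modTheta_sq_mul (hq : ‖q‖ < 1) (hq0 : q ≠ 0) {x : ℂ} (hx : x ≠ 0) :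
    modTheta q (q ^ 2 * x) * (q * x ^ 2) = modTheta q x := by
  have h1 : qPoch x q = (1 - x) * ((1 - x * q) * qPoch (q ^ 2 * x) q) := by
    rw [qPoch_step hq, qPoch_step hq (x * q)]; ring_nf
  have h2 : qPoch (q / (q ^ 2 * x)) q = (1 - 1 / (q * x)) * ((1 - 1 / x) * qPoch (q / x) q) := by
    rw [qPoch_step hq, show q / (q ^ 2 * x) = 1 / (q * x) by field_simp,
      qPoch_step hq (1 / (q * x) * q), show 1 / (q * x) * q = 1 / x by field_simp,
      show 1 / x * q = q / x by ring]
  rw [modTheta, modTheta, h1, h2]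
  field_simp
  ring

lemma modTheta_inv (hq : ‖q‖ < 1) {x : ℂ} (hx : x ≠ 0) :
    modTheta q x⁻¹ * x = -modTheta q x := by
  rw [modTheta_eq hq x, modTheta_eq hq x⁻¹, div_inv_eq_mul, ← div_eq_mul_inv]
  field_simp
  ring

lemma modTheta_ne_zero (hq : ‖q‖ < 1) (hq0 : q ≠ 0) {x : ℂ} (hx : x ≠ 0)
    (h : ∀ k : ℤ, x ≠ q ^ k) : modTheta q x ≠ 0 := by
  refine mul_ne_zero (qPoch_ne_zero hq fun n hn => h (-n) ?_)
    (qPoch_ne_zero hq fun n hn => h (n + 1) ?_)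
  · rw [zpow_neg, zpow_natCast]; exact eq_inv_of_mul_eq_one_left hn
  · rw [zpow_add₀ hq0, zpow_natCast, zpow_one]
    field_simp at hn
    rw [← hn]; ring

end qPochBasics

/-! ### The bilateral summand: decay, telescoping certificate, recurrence in a. -/

section BilateralSum

variable {q : ℂ}

/-- The summand of the very-well-poised bilateral series as a function of `z`:
`(az, a/z, bz, b/z, cz, c/z, dz, d/z; q)_∞ / (q z², q/z²; q)_∞`. -/
noncomputable def wpTerm (q a b c d z : ℂ) : ℂ :=
  qPoch (a * z) q * qPoch (a / z) q * (qPoch (b * z) q * qPoch (b / z) q) *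
    (qPoch (c * z) q * qPoch (c / z) q) * (qPoch (d * z) q * qPoch (d / z) q) /
    (qPoch (q * z ^ 2) q * qPoch (q / z ^ 2) q)

/-- The factor `(a/z, b/z, c/z, d/z; q)_∞ / θ(z²; q)` that governs the decay of `wpTerm`
as `z → 0`. -/
noncomputable def wpTail (q a b c d z : ℂ) : ℂ :=
  qPoch (a / z) q * qPoch (b / z) q * qPoch (c / z) q * qPoch (d / z) q / modTheta q (z ^ 2)

/-- The certificate for telescoping the recurrence of `wpTerm` in `a`. -/
noncomputable def wpCert (q a b c d z : ℂ) : ℂ :=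
  -(a / z) * (qPoch (a * z) q * qPoch (a * q / z) q) * (qPoch (b * z / q) q * qPoch (b / z) q) *
    (qPoch (c * z / q) q * qPoch (c / z) q) * (qPoch (d * z / q) q * qPoch (d / z) q) /
    modTheta q (z ^ 2)

/-- This symmetry reduces the behaviour as n → -∞ to that as n → +∞. -/
lemma wpTerm_inv (a b c d z : ℂ) : wpTerm q a b c d z⁻¹ = wpTerm q a b c d z := by
  simp only [wpTerm, inv_pow, div_inv_eq_mul, ← div_eq_mul_inv]
  ring

/-- Separates the factors that stay bounded as z → 0 from `wpTail`, which obeys a first-order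
recursion under z ↦ qz. -/
lemma wpTerm_eq (hq : ‖q‖ < 1) (a b c d : ℂ) {z : ℂ} (hz : z ^ 2 ≠ 1) :
    wpTerm q a b c d z = (1 - z ^ 2) * (qPoch (a * z) q * qPoch (b * z) q * qPoch (c * z) q *
      qPoch (d * z) q) * wpTail q a b c d z := by
  have : 1 - z ^ 2 ≠ 0 := sub_ne_zero.mpr hz.symm
  rw [wpTerm, wpTail, modTheta_eq hq, mul_div_assoc', mul_assoc (1 - z ^ 2),
    mul_div_mul_left _ _ this]
  ring

lemma qPoch_div_mul (hq : ‖q‖ < 1) (hq0 : q ≠ 0) (a z : ℂ) :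
    qPoch (a / (q * z)) q = (1 - a / (q * z)) * qPoch (a / z) q := by
  rw [qPoch_step hq, show a / (q * z) * q = a / z by field_simp]

/-- The multiplier tends to abcd/q³ as z → 0; this is where the convergence condition |abcd/q³| < 1
originates. -/
lemma wpTail_mul (hq : ‖q‖ < 1) (hq0 : q ≠ 0) (a b c d : ℂ) {z : ℂ} (hz : z ≠ 0) :
    wpTail q a b c d (q * z) =
      wpTail q a b c d z * ((q * z - a) * (q * z - b) * (q * z - c) * (q * z - d) / q ^ 3) := by
  rw [wpTail, wpTail, ← modTheta_sq_mul hq hq0 (pow_ne_zero 2 hz), mul_pow]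
  simp only [qPoch_div_mul hq hq0]
  generalize modTheta q (q ^ 2 * z ^ 2) = θ
  -- If θ = 0, both sides are divisions by zero, hence 0.
  rcases eq_or_ne θ 0 with rfl | hθ
  · simp
  · field_simp

/-- The sequence dominating `wpTail` along a geometric progression. -/
noncomputable def wpMajorant (r R A B C D : ℝ) (n : ℕ) : ℝ :=
  ∏ k ∈ Finset.range n, ((r ^ (k + 1) * R + A) * (r ^ (k + 1) * R + B) * (r ^ (k + 1) * R + C) *
    (r ^ (k + 1) * R + D) / r ^ 3)

lemma summable_wpMajorant {r R A B C D : ℝ} (hr0 : 0 < r) (hr : r < 1) (hR : 0 ≤ R) (hA : 0 ≤ A)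
    (hB : 0 ≤ B) (hC : 0 ≤ C) (hD : 0 ≤ D) (h : A * B * C * D / r ^ 3 < 1) :
    Summable (wpMajorant r R A B C D) := by
  have hp : Tendsto (fun k : ℕ => r ^ (k + 1) * R) atTop (𝓝 0) := by
    simpa using ((tendsto_pow_atTop_nhds_zero_of_lt_one hr0.le hr).comp
      (tendsto_add_atTop_nat 1)).mul_const R
  have hlim : Tendsto (fun k : ℕ => (r ^ (k + 1) * R + A) * (r ^ (k + 1) * R + B) *
      (r ^ (k + 1) * R + C) * (r ^ (k + 1) * R + D) / r ^ 3) atTop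
      (𝓝 ((0 + A) * (0 + B) * (0 + C) * (0 + D) / r ^ 3)) :=
    ((((hp.add_const A).mul (hp.add_const B)).mul (hp.add_const C)).mul
      (hp.add_const D)).div_const _
  simp only [zero_add] at hlim
  -- Ratio test: the ratios tend to ABCD/r³, so they are eventually below some s < 1.
  obtain ⟨s, hs, hs1⟩ := exists_between h
  refine summable_of_ratio_norm_eventually_le hs1 ?_
  filter_upwards [hlim.eventually (gt_mem_nhds hs)] with n hn
  rw [wpMajorant, Finset.prod_range_succ, norm_mul, mul_comm]
  refine mul_le_mul_of_nonneg_right ?_ (norm_nonneg _)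
  rw [Real.norm_of_nonneg (by positivity)]
  exact hn.le

lemma wpMajorant_nonneg {r R A B C D : ℝ} (hr0 : 0 ≤ r) (hR : 0 ≤ R) (hA : 0 ≤ A)
    (hB : 0 ≤ B) (hC : 0 ≤ C) (hD : 0 ≤ D) (n : ℕ) : 0 ≤ wpMajorant r R A B C D n :=
  Finset.prod_nonneg fun _ _ => by positivity

/-- Upper bounds R, A, …, D replace the norms themselves so that one majorant serves all x in [0,1]
and all the parameters aq^N. -/
lemma norm_wpTail_mul_pow_le (hq : ‖q‖ < 1) (hq0 : q ≠ 0) {a b c d z : ℂ} (hz : z ≠ 0)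
    {R A B C D : ℝ} (hR : ‖z‖ ≤ R) (hA : ‖a‖ ≤ A) (hB : ‖b‖ ≤ B) (hC : ‖c‖ ≤ C) (hD : ‖d‖ ≤ D)
    (n : ℕ) :
    ‖wpTail q a b c d (z * q ^ n)‖ ≤ ‖wpTail q a b c d z‖ * wpMajorant ‖q‖ R A B C D n := by
  induction n with
  | zero => simp [wpMajorant]
  | succ n ih =>
    have key : ∀ {e : ℂ} {E : ℝ}, ‖e‖ ≤ E →
        ‖q * (z * q ^ n) - e‖ ≤ ‖q‖ ^ (n + 1) * R + E := by
      intro e E he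
      refine (norm_sub_le _ _).trans (add_le_add ?_ he)
      rw [show q * (z * q ^ n) = q ^ (n + 1) * z by ring, norm_mul, norm_pow]
      gcongr
    have hR0 : 0 ≤ R := (norm_nonneg _).trans hR
    have hA0 : 0 ≤ A := (norm_nonneg _).trans hA
    have hB0 : 0 ≤ B := (norm_nonneg _).trans hB
    have hC0 : 0 ≤ C := (norm_nonneg _).trans hC
    have hD0 : 0 ≤ D := (norm_nonneg _).trans hD
    have hm := wpMajorant_nonneg (norm_nonneg q) hR0 hA0 hB0 hC0 hD0 n
    rw [show z * q ^ (n + 1) = q * (z * q ^ n) by ring,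
      wpTail_mul hq hq0 a b c d (mul_ne_zero hz (pow_ne_zero n hq0)), norm_mul, wpMajorant,
      Finset.prod_range_succ, ← wpMajorant, ← mul_assoc ‖wpTail q a b c d z‖]
    refine mul_le_mul ih ?_ (norm_nonneg _) (mul_nonneg (norm_nonneg _) hm)
    rw [norm_div, norm_mul, norm_mul, norm_mul, norm_pow]
    gcongr
    exacts [key hA, key hB, key hC, key hD]

/-- The constant in front of `wpMajorant` in the bound for `wpTerm`. -/
noncomputable def wpConst (r R T A B C D : ℝ) : ℝ :=
  (1 + R ^ 2) * (Real.exp (A * R / (1 - r)) * Real.exp (B * R / (1 - r)) *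
    Real.exp (C * R / (1 - r)) * Real.exp (D * R / (1 - r))) *
  ((Real.exp (A * R / (1 - r)) * Real.exp (B * R / (1 - r)) *
    Real.exp (C * R / (1 - r)) * Real.exp (D * R / (1 - r))) * T)

lemma norm_wpTail_le (hq : ‖q‖ < 1) {a b c d z : ℂ}
    {R T A B C D : ℝ} (hR : ‖z⁻¹‖ ≤ R) (hT : ‖(modTheta q (z ^ 2))⁻¹‖ ≤ T)
    (hA : ‖a‖ ≤ A) (hB : ‖b‖ ≤ B) (hC : ‖c‖ ≤ C) (hD : ‖d‖ ≤ D) :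
    ‖wpTail q a b c d z‖ ≤ Real.exp (A * R / (1 - ‖q‖)) * Real.exp (B * R / (1 - ‖q‖)) *
      Real.exp (C * R / (1 - ‖q‖)) * Real.exp (D * R / (1 - ‖q‖)) * T := by
  have key : ∀ {e : ℂ} {E : ℝ}, ‖e‖ ≤ E → ‖qPoch (e / z) q‖ ≤ Real.exp (E * R / (1 - ‖q‖)) := by
    intro e E he
    refine norm_qPoch_le_of_le hq ?_
    rw [div_eq_mul_inv, norm_mul]
    exact mul_le_mul he hR (norm_nonneg _) ((norm_nonneg _).trans he)
  rw [wpTail, div_eq_mul_inv, norm_mul, norm_mul, norm_mul, norm_mul]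
  gcongr
  exacts [key hA, key hB, key hC, key hD]

lemma norm_qPoch_mul_pow_le (hq : ‖q‖ < 1) {e z : ℂ} {R E : ℝ} (hR : ‖z‖ ≤ R) (he : ‖e‖ ≤ E)
    (n : ℕ) : ‖qPoch (e * (z * q ^ n)) q‖ ≤ Real.exp (E * R / (1 - ‖q‖)) := by
  refine norm_qPoch_le_of_le hq ?_
  rw [norm_mul, norm_mul, norm_pow]
  refine mul_le_mul he ?_ (by positivity) ((norm_nonneg _).trans he)
  exact (mul_le_of_le_one_right (norm_nonneg _) (pow_le_one₀ (norm_nonneg _) hq.le)).trans hR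

lemma norm_wpTerm_mul_pow_le (hq : ‖q‖ < 1) (hq0 : q ≠ 0) {a b c d z : ℂ} (hz : z ≠ 0)
    (hzq : ∀ k : ℤ, z ^ 2 ≠ q ^ k)
    {R T A B C D : ℝ} (hR : ‖z‖ ≤ R) (hR' : ‖z⁻¹‖ ≤ R) (hT : ‖(modTheta q (z ^ 2))⁻¹‖ ≤ T)
    (hA : ‖a‖ ≤ A) (hB : ‖b‖ ≤ B) (hC : ‖c‖ ≤ C) (hD : ‖d‖ ≤ D) (n : ℕ) :
    ‖wpTerm q a b c d (z * q ^ n)‖ ≤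
      wpConst ‖q‖ R T A B C D * wpMajorant ‖q‖ R A B C D n := by
  have hne : (z * q ^ n) ^ 2 ≠ 1 := by
    intro h
    refine hzq (-(2 * n)) ?_
    rw [zpow_neg, eq_comm, inv_eq_iff_eq_inv, ← one_div, eq_div_iff (pow_ne_zero 2 hz), ← h]
    norm_cast
    ring
  have hm := wpMajorant_nonneg (norm_nonneg q) ((norm_nonneg _).trans hR)
    ((norm_nonneg _).trans hA) ((norm_nonneg _).trans hB) ((norm_nonneg _).trans hC)
    ((norm_nonneg _).trans hD) n
  rw [wpTerm_eq hq a b c d hne, norm_mul, wpConst, mul_assoc _ _ (wpMajorant _ _ _ _ _ _ n)]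
  have h1 := norm_wpTail_mul_pow_le hq hq0 hz hR hA hB hC hD n
  have h2 := norm_wpTail_le hq hR' hT hA hB hC hD
  refine mul_le_mul ?_ (h1.trans (mul_le_mul_of_nonneg_right h2 hm)) (norm_nonneg _)
    (by positivity)
  rw [norm_mul, norm_mul, norm_mul, norm_mul]
  gcongr
  · refine (norm_sub_le _ _).trans ?_
    rw [norm_one, norm_pow, norm_mul, norm_pow]
    gcongr
    exact (mul_le_of_le_one_right (norm_nonneg _) (pow_le_one₀ (norm_nonneg _) hq.le)).trans hR
  exacts [norm_qPoch_mul_pow_le hq hR hA n, norm_qPoch_mul_pow_le hq hR hB n,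
    norm_qPoch_mul_pow_le hq hR hC n, norm_qPoch_mul_pow_le hq hR hD n]

lemma norm_wpTerm_mul_zpow_le (hq : ‖q‖ < 1) (hq0 : q ≠ 0) {a b c d z : ℂ} (hz : z ≠ 0)
    (hzq : ∀ k : ℤ, z ^ 2 ≠ q ^ k)
    {R T A B C D : ℝ} (hR : ‖z‖ ≤ R) (hR' : ‖z⁻¹‖ ≤ R) (hT : ‖(modTheta q (z ^ 2))⁻¹‖ ≤ T)
    (hT' : ‖(modTheta q (z⁻¹ ^ 2))⁻¹‖ ≤ T)
    (hA : ‖a‖ ≤ A) (hB : ‖b‖ ≤ B) (hC : ‖c‖ ≤ C) (hD : ‖d‖ ≤ D) (n : ℤ) :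
    ‖wpTerm q a b c d (z * q ^ n)‖ ≤
      wpConst ‖q‖ R T A B C D * wpMajorant ‖q‖ R A B C D n.natAbs := by
  obtain ⟨m, rfl | rfl⟩ := n.eq_nat_or_neg
  · simpa using norm_wpTerm_mul_pow_le hq hq0 hz hzq hR hR' hT hA hB hC hD m
  · rw [← wpTerm_inv, mul_inv, zpow_neg, inv_inv, zpow_natCast, Int.natAbs_neg, Int.natAbs_natCast]
    refine norm_wpTerm_mul_pow_le hq hq0 (inv_ne_zero hz) (fun k h => hzq (-k) ?_) hR'
      (by rwa [inv_inv]) hT' hA hB hC hD m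
    rw [zpow_neg, ← h, inv_pow, inv_inv]

lemma summable_wpMajorant_natAbs {r R A B C D : ℝ} (hr0 : 0 < r) (hr : r < 1) (hR : 0 ≤ R)
    (hA : 0 ≤ A) (hB : 0 ≤ B) (hC : 0 ≤ C) (hD : 0 ≤ D) (h : A * B * C * D / r ^ 3 < 1) :
    Summable fun n : ℤ => wpMajorant r R A B C D n.natAbs := by
  have := summable_wpMajorant hr0 hr hR hA hB hC hD h
  exact Summable.of_nat_of_neg (by simpa using this) (by simpa using this)

/-- A dominating sequence for the bilateral series, uniform in the parameters. -/
lemma exists_summable_bound_wpTerm (hq : ‖q‖ < 1) (hq0 : q ≠ 0) {z : ℂ} (hz : z ≠ 0)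
    (hzq : ∀ k : ℤ, z ^ 2 ≠ q ^ k) {a b c d : ℂ} (h : ‖a * b * c * d / q ^ 3‖ < 1) :
    ∃ g : ℤ → ℝ, Summable g ∧
      ∀ a' : ℂ, ‖a'‖ ≤ ‖a‖ → ∀ n : ℤ, ‖wpTerm q a' b c d (z * q ^ n)‖ ≤ g n := by
  refine ⟨fun n => wpConst ‖q‖ (max ‖z‖ ‖z⁻¹‖)
      (max ‖(modTheta q (z ^ 2))⁻¹‖ ‖(modTheta q (z⁻¹ ^ 2))⁻¹‖) ‖a‖ ‖b‖ ‖c‖ ‖d‖ *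
      wpMajorant ‖q‖ (max ‖z‖ ‖z⁻¹‖) ‖a‖ ‖b‖ ‖c‖ ‖d‖ n.natAbs, ?_, fun a' ha' n => ?_⟩
  · refine (summable_wpMajorant_natAbs (norm_pos_iff.mpr hq0) hq (by positivity) (norm_nonneg _)
      (norm_nonneg _) (norm_nonneg _) (norm_nonneg _) ?_).mul_left _
    simpa using h
  · exact norm_wpTerm_mul_zpow_le hq hq0 hz hzq (le_max_left _ _) (le_max_right _ _)
      (le_max_left _ _) (le_max_right _ _) ha' le_rfl le_rfl le_rfl n

/-- Plays for the certificate the role that `wpTerm_inv` plays for the summand: it carries negative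
indices to positive ones. -/
lemma wpCert_inv (hq : ‖q‖ < 1) (hq0 : q ≠ 0) (a b c d : ℂ) {z : ℂ} (hz : z ≠ 0)
    (hzq : ∀ k : ℤ, z ^ 2 ≠ q ^ k) :
    wpCert q a b c d z⁻¹ = -wpCert q a b c d (q * z) := by
  have h1 : modTheta q (z ^ 2)⁻¹ = -(modTheta q (z ^ 2) / z ^ 2) := by
    rw [← neg_div, eq_div_iff (pow_ne_zero 2 hz), modTheta_inv hq (pow_ne_zero 2 hz)]
  have h2 : modTheta q (q ^ 2 * z ^ 2) = modTheta q (z ^ 2) / (q * (z ^ 2) ^ 2) := by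
    rw [eq_div_iff (by positivity), modTheta_sq_mul hq hq0 (pow_ne_zero 2 hz)]
  have hθ := modTheta_ne_zero hq hq0 (pow_ne_zero 2 hz) hzq
  have h3 : ∀ e : ℂ, e * z⁻¹ / q = e / (q * z) := fun e => by field_simp
  have h4 : ∀ e : ℂ, e * (q * z) / q = e * z := fun e => by field_simp
  have h5 : a * q / (q * z) = a / z := by field_simp
  simp only [wpCert, inv_pow, h1, mul_pow, h2, h3, h4, h5, div_inv_eq_mul]
  rw [← div_eq_mul_inv, mul_assoc a q z]
  field_simp

/-- Since (a/z; q)_∞ - (aq/z; q)_∞ = -(a/z)(aq/z; q)_∞, the certificate is a difference of two tails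
times factors bounded near z = 0, so the decay of `wpTail` gives its summability. -/
lemma wpCert_eq (hq : ‖q‖ < 1) (a b c d z : ℂ) :
    wpCert q a b c d z = (qPoch (a * z) q * qPoch (b / q * z) q * qPoch (c / q * z) q *
      qPoch (d / q * z) q) * (wpTail q a b c d z - wpTail q (a * q) b c d z) := by
  have h : ∀ e : ℂ, e * z / q = e / q * z := fun e => by ring
  rw [wpCert, wpTail, wpTail, qPoch_step hq (a / z), show a / z * q = a * q / z by ring]
  simp only [h]
  ring

lemma summable_wpCert_nat (hq : ‖q‖ < 1) (hq0 : q ≠ 0) {a b c d : ℂ} {z : ℂ} (hz : z ≠ 0)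
    (h : ‖a * b * c * d / q ^ 3‖ < 1) : Summable fun n : ℕ => wpCert q a b c d (z * q ^ n) := by
  have hm := summable_wpMajorant (norm_pos_iff.mpr hq0) hq (norm_nonneg z) (norm_nonneg a)
    (norm_nonneg b) (norm_nonneg c) (norm_nonneg d) (by simpa using h)
  have haq : ‖a * q‖ ≤ ‖a‖ := by
    rw [norm_mul]; exact mul_le_of_le_one_right (norm_nonneg _) hq.le
  refine .of_norm_bounded (hm.mul_left (Real.exp (‖a‖ * ‖z‖ / (1 - ‖q‖)) *
    Real.exp (‖b / q‖ * ‖z‖ / (1 - ‖q‖)) * Real.exp (‖c / q‖ * ‖z‖ / (1 - ‖q‖)) *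
    Real.exp (‖d / q‖ * ‖z‖ / (1 - ‖q‖)) *
    (‖wpTail q a b c d z‖ + ‖wpTail q (a * q) b c d z‖))) fun n => ?_
  rw [wpCert_eq hq, norm_mul, mul_assoc _ _ (wpMajorant _ _ _ _ _ _ n)]
  refine mul_le_mul ?_ ?_ (norm_nonneg _) (by positivity)
  · rw [norm_mul, norm_mul, norm_mul]
    gcongr <;> exact norm_qPoch_mul_pow_le hq le_rfl le_rfl n
  · rw [add_mul]
    exact (norm_sub_le _ _).trans (add_le_add
      (norm_wpTail_mul_pow_le hq hq0 hz le_rfl le_rfl le_rfl le_rfl le_rfl n)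
      (norm_wpTail_mul_pow_le hq hq0 hz le_rfl haq le_rfl le_rfl le_rfl n))

lemma sq_mul_zpow_ne (hq0 : q ≠ 0) {z : ℂ} (hzq : ∀ k : ℤ, z ^ 2 ≠ q ^ k) (n k : ℤ) :
    (z * q ^ n) ^ 2 ≠ q ^ k := by
  intro h
  refine hzq (k - (n + n)) ?_
  rw [zpow_sub₀ hq0, ← h, zpow_add₀ hq0]
  have := zpow_ne_zero n hq0
  field_simp

lemma summable_wpCert (hq : ‖q‖ < 1) (hq0 : q ≠ 0) {a b c d : ℂ} {z : ℂ} (hz : z ≠ 0)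
    (hzq : ∀ k : ℤ, z ^ 2 ≠ q ^ k)
    (h : ‖a * b * c * d / q ^ 3‖ < 1) : Summable fun n : ℤ => wpCert q a b c d (z * q ^ n) := by
  refine Summable.of_nat_of_neg (by simpa using summable_wpCert_nat hq hq0 hz h) ?_
  have h1 := (summable_wpCert_nat hq hq0 (mul_ne_zero hq0 (inv_ne_zero hz)) h).neg
  refine h1.congr fun n => ?_
  -- Reflecting at (zq^{-n})⁻¹ turns the term of index -n based at z into minus the term of index n
  -- based at q/z.
  have h2 := wpCert_inv hq hq0 a b c d (z := (z * q ^ (-(n : ℤ)))⁻¹)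
    (inv_ne_zero (mul_ne_zero hz (zpow_ne_zero _ hq0))) (fun k hk =>
      sq_mul_zpow_ne hq0 hzq (-n) (-k) (by rw [zpow_neg q k, ← hk, inv_pow, inv_inv]))
  rw [inv_inv] at h2
  rw [h2, mul_inv, zpow_neg, inv_inv, zpow_natCast, mul_assoc]

lemma wpTerm_recurrence (hq : ‖q‖ < 1) (hq0 : q ≠ 0) (a b c d : ℂ) {z : ℂ} (hz : z ≠ 0)
    (hzq : ∀ k : ℤ, z ^ 2 ≠ q ^ k) :
    (1 - a * b / q) * (1 - a * c / q) * (1 - a * d / q) * wpTerm q (a * q) b c d z -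
      (1 - a * b * c * d / q ^ 3) * wpTerm q a b c d z =
      wpCert q a b c d (q * z) - wpCert q a b c d z := by
  have hz2 := pow_ne_zero 2 hz
  have h1z : 1 - z ^ 2 ≠ 0 := sub_ne_zero.mpr fun h => hzq 0 (by simpa using h.symm)
  have hθ := modTheta_ne_zero hq hq0 hz2 hzq
  have h2 : modTheta q (q ^ 2 * z ^ 2) = modTheta q (z ^ 2) / (q * (z ^ 2) ^ 2) := by
    rw [eq_div_iff (by positivity), modTheta_sq_mul hq hq0 hz2]
  have h3 : qPoch (q * z ^ 2) q * qPoch (q / z ^ 2) q = modTheta q (z ^ 2) / (1 - z ^ 2) := by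
    rw [modTheta_eq hq, mul_div_cancel_left₀ _ h1z]
  have h4 : ∀ e : ℂ, e * (q * z) / q = e * z := fun e => by field_simp
  have h5 : a * q / (q * z) = a / z := by field_simp
  have h6 : ∀ e : ℂ, qPoch (e * z / q) q = (1 - e * z / q) * qPoch (e * z) q := fun e => by
    rw [qPoch_step hq, div_mul_cancel₀ _ hq0]
  have h7 : qPoch (a * z) q = (1 - a * z) * qPoch (a * q * z) q := by
    rw [qPoch_step hq]; ring_nf
  have h8 : qPoch (a / z) q = (1 - a / z) * qPoch (a * q / z) q := by
    rw [qPoch_step hq]; ring_nf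
  simp only [wpTerm, wpCert, h3, mul_pow, h2, h4, h5, h6, qPoch_div_mul hq hq0, h7, h8,
    ← mul_assoc a q z]
  -- Every term is now a rational function times the same product of eight factorials over θ; what
  -- remains is a rational identity in a, b, c, d, q, z.
  generalize modTheta q (z ^ 2) = θ at *
  generalize qPoch (a * q * z) q = X₁
  generalize qPoch (a * q / z) q = X₂
  generalize qPoch (b * z) q = X₃
  generalize qPoch (b / z) q = X₄
  generalize qPoch (c * z) q = X₅
  generalize qPoch (c / z) q = X₆
  generalize qPoch (d * z) q = X₇
  generalize qPoch (d / z) q = X₈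
  field_simp
  ring

end BilateralSum

/-! ### Evaluation of the bilateral sum. -/

section BilateralSumValue

variable {q : ℂ}

lemma summable_wpTerm (hq : ‖q‖ < 1) (hq0 : q ≠ 0) {z : ℂ} (hz : z ≠ 0)
    (hzq : ∀ k : ℤ, z ^ 2 ≠ q ^ k) {a b c d : ℂ} (h : ‖a * b * c * d / q ^ 3‖ < 1) :
    Summable fun n : ℤ => wpTerm q a b c d (z * q ^ n) := by
  obtain ⟨g, hg, hb⟩ := exists_summable_bound_wpTerm hq hq0 hz hzq h
  exact .of_norm_bounded hg (hb a le_rfl)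

lemma norm_mul_pow_param_lt (hq : ‖q‖ < 1) {a b c d : ℂ} (h : ‖a * b * c * d / q ^ 3‖ < 1)
    (N : ℕ) : ‖a * q ^ N * b * c * d / q ^ 3‖ < 1 := by
  rw [show a * q ^ N * b * c * d / q ^ 3 = a * b * c * d / q ^ 3 * q ^ N by ring, norm_mul, norm_pow]
  exact mul_lt_one_of_nonneg_of_lt_one_left (norm_nonneg _) h
    (pow_le_one₀ (norm_nonneg _) hq.le)

/-- The certificate is summable over ℤ, so its sum is unchanged by n ↦ n + 1 and the differences add
up to zero. -/
lemma tsum_wpTerm_recurrence (hq : ‖q‖ < 1) (hq0 : q ≠ 0) {z : ℂ} (hz : z ≠ 0)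
    (hzq : ∀ k : ℤ, z ^ 2 ≠ q ^ k) {a b c d : ℂ} (h : ‖a * b * c * d / q ^ 3‖ < 1) :
    (1 - a * b * c * d / q ^ 3) * ∑' n : ℤ, wpTerm q a b c d (z * q ^ n) =
      (1 - a * b / q) * (1 - a * c / q) * (1 - a * d / q) *
        ∑' n : ℤ, wpTerm q (a * q) b c d (z * q ^ n) := by
  have hF := summable_wpTerm hq hq0 hz hzq h
  have hF' : Summable fun n : ℤ => wpTerm q (a * q) b c d (z * q ^ n) :=
    summable_wpTerm hq hq0 hz hzq (by simpa using norm_mul_pow_param_lt hq h 1)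
  have hG := summable_wpCert hq hq0 hz hzq h
  have hG' : Summable fun n : ℤ => wpCert q a b c d (z * q ^ (n + 1)) :=
    (Equiv.addRight (1 : ℤ)).summable_iff.mpr hG
  have hGG : ∑' n : ℤ, wpCert q a b c d (z * q ^ (n + 1)) = ∑' n : ℤ, wpCert q a b c d (z * q ^ n) :=
    (Equiv.addRight (1 : ℤ)).tsum_eq fun n => wpCert q a b c d (z * q ^ n)
  rw [← tsum_mul_left, ← tsum_mul_left, eq_comm, ← sub_eq_zero,
    ← (hF'.mul_left _).tsum_sub (hF.mul_left _), ← sub_eq_zero.mpr hGG, ← hG'.tsum_sub hG]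
  refine tsum_congr fun n => ?_
  rw [wpTerm_recurrence hq hq0 a b c d (mul_ne_zero hz (zpow_ne_zero _ hq0))
    (sq_mul_zpow_ne hq0 hzq n), zpow_add₀ hq0, zpow_one]
  ring_nf

lemma tsum_wpTerm_iterate (hq : ‖q‖ < 1) (hq0 : q ≠ 0) {z : ℂ} (hz : z ≠ 0)
    (hzq : ∀ k : ℤ, z ^ 2 ≠ q ^ k) {a b c d : ℂ} (h : ‖a * b * c * d / q ^ 3‖ < 1) (N : ℕ) :
    (∏ k ∈ Finset.range N, (1 - a * b * c * d / q ^ 3 * q ^ k)) *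
        ∑' n : ℤ, wpTerm q a b c d (z * q ^ n) =
      (∏ k ∈ Finset.range N, (1 - a * b / q * q ^ k)) *
        (∏ k ∈ Finset.range N, (1 - a * c / q * q ^ k)) *
        (∏ k ∈ Finset.range N, (1 - a * d / q * q ^ k)) *
        ∑' n : ℤ, wpTerm q (a * q ^ N) b c d (z * q ^ n) := by
  induction N with
  | zero => simp
  | succ N ih =>
    have hr := tsum_wpTerm_recurrence hq hq0 hz hzq (norm_mul_pow_param_lt hq h N)
    rw [mul_assoc a (q ^ N) q, ← pow_succ] at hr
    simp only [Finset.prod_range_succ]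
    generalize ∑' n : ℤ, wpTerm q (a * q ^ (N + 1)) b c d (z * q ^ n) = S₁ at *
    linear_combination (1 - a * b * c * d / q ^ 3 * q ^ N) * ih +
      (∏ k ∈ Finset.range N, (1 - a * b / q * q ^ k)) *
        (∏ k ∈ Finset.range N, (1 - a * c / q * q ^ k)) *
        (∏ k ∈ Finset.range N, (1 - a * d / q * q ^ k)) * hr

/-- Limit N → ∞ of `tsum_wpTerm_iterate`: the finite products become infinite ones, and the
dominating sequence is uniform over |a'| ≤ |a|, which covers every aq^N. -/
lemma tsum_wpTerm_reduce (hq : ‖q‖ < 1) (hq0 : q ≠ 0) {z : ℂ} (hz : z ≠ 0)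
    (hzq : ∀ k : ℤ, z ^ 2 ≠ q ^ k) {a b c d : ℂ} (h : ‖a * b * c * d / q ^ 3‖ < 1) :
    qPoch (a * b * c * d / q ^ 3) q * ∑' n : ℤ, wpTerm q a b c d (z * q ^ n) =
      qPoch (a * b / q) q * qPoch (a * c / q) q * qPoch (a * d / q) q *
        ∑' n : ℤ, wpTerm q 0 b c d (z * q ^ n) := by
  have hpow : Tendsto (fun N : ℕ => a * q ^ N) atTop (𝓝 0) := by
    simpa using (tendsto_pow_atTop_nhds_zero_of_norm_lt_one hq).const_mul a
  have hS : Tendsto (fun N : ℕ => ∑' n : ℤ, wpTerm q (a * q ^ N) b c d (z * q ^ n)) atTop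
      (𝓝 (∑' n : ℤ, wpTerm q 0 b c d (z * q ^ n))) := by
    obtain ⟨g, hg, hb⟩ := exists_summable_bound_wpTerm hq hq0 hz hzq h
    refine tendsto_tsum_of_dominated_convergence hg (fun n => ?_)
      (Eventually.of_forall fun N => hb _ ?_)
    · have hc : Continuous fun a : ℂ => wpTerm q a b c d (z * q ^ n) := by
        have := continuous_qPoch hq
        simp only [wpTerm]
        fun_prop
      exact (hc.tendsto 0).comp hpow
    · rw [norm_mul, norm_pow]
      exact mul_le_of_le_one_right (norm_nonneg _) (pow_le_one₀ (norm_nonneg _) hq.le)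
  refine tendsto_nhds_unique (((tendsto_finset_prod_qPoch hq _).mul_const _).congr
    (tsum_wpTerm_iterate hq hq0 hz hzq h)) ?_
  exact (((tendsto_finset_prod_qPoch hq _).mul (tendsto_finset_prod_qPoch hq _)).mul
    (tendsto_finset_prod_qPoch hq _)).mul hS

lemma qPoch_ne_zero_of_zpow_ne (hq : ‖q‖ < 1) {x : ℂ} (h : ∀ k : ℤ, x ≠ q ^ k) :
    qPoch x q ≠ 0 := by
  refine qPoch_ne_zero hq fun n hn => h (-n) ?_
  rw [zpow_neg, zpow_natCast]
  exact eq_inv_of_mul_eq_one_left hn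

/-- The choice a = q/z puts (q^{n+1}; q)_∞ in the numerator, which vanishes for n < 0; b = qz puts
(q^{1-n}; q)_∞ there, which vanishes for n > 0. -/
lemma tsum_wpTerm_terminating (hq : ‖q‖ < 1) (hq0 : q ≠ 0) {z : ℂ} (hz : z ≠ 0)
    (hzq : ∀ k : ℤ, z ^ 2 ≠ q ^ k) :
    ∑' n : ℤ, wpTerm q (q / z) (q * z) 0 0 (z * q ^ n) = qPoch q q ^ 2 := by
  rw [tsum_eq_single 0]
  · have h1 : qPoch (q * z ^ 2) q ≠ 0 := by
      refine qPoch_ne_zero_of_zpow_ne hq fun k hk => hzq (k - 1) ?_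
      rw [zpow_sub₀ hq0, ← hk, zpow_one]; field_simp
    have h2 : qPoch (q / z ^ 2) q ≠ 0 := by
      refine qPoch_ne_zero_of_zpow_ne hq fun k hk => hzq (1 - k) ?_
      rw [zpow_sub₀ hq0, ← hk, zpow_one]; field_simp
    simp only [wpTerm, zpow_zero, mul_one, zero_mul, zero_div, qPoch_zero]
    rw [div_mul_cancel₀ _ hz, mul_div_cancel_right₀ _ hz, div_div, ← sq, mul_assoc q z z, ← sq]
    field_simp
  · intro n hn
    rcases lt_or_gt_of_ne hn with hn | hn
    · obtain ⟨m, rfl⟩ : ∃ m : ℕ, n = -(m + 1 : ℕ) := ⟨(-n - 1).toNat, by omega⟩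
      have : qPoch (q / z * (z * q ^ (-((m + 1 : ℕ) : ℤ)))) q = 0 := by
        refine qPoch_eq_zero_of_mul_pow m ?_
        rw [zpow_neg, zpow_natCast]
        field_simp
        ring
      rw [wpTerm, this]
      simp only [zero_mul, zero_div]
    · obtain ⟨m, rfl⟩ : ∃ m : ℕ, n = (m + 1 : ℕ) := ⟨(n - 1).toNat, by omega⟩
      have : qPoch (q * z / (z * q ^ ((m + 1 : ℕ) : ℤ))) q = 0 := by
        refine qPoch_eq_zero_of_mul_pow m ?_
        rw [zpow_natCast]
        field_simp
        ring
      rw [wpTerm, this]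
      simp only [zero_mul, mul_zero, zero_div]

lemma wpTerm_swap_left (a b c d z : ℂ) : wpTerm q a b c d z = wpTerm q b a c d z := by
  simp only [wpTerm]; ring

lemma wpTerm_swap_left_third (a b c d z : ℂ) : wpTerm q a b c d z = wpTerm q c b a d z := by
  simp only [wpTerm]; ring

lemma wpTerm_swap_left_fourth (a b c d z : ℂ) : wpTerm q a b c d z = wpTerm q d b c a z := by
  simp only [wpTerm]; ring

lemma tsum_wpTerm_zero_left (hq : ‖q‖ < 1) (hq0 : q ≠ 0) {z : ℂ} (hz : z ≠ 0)
    (hzq : ∀ k : ℤ, z ^ 2 ≠ q ^ k) (b c d : ℂ) :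
    ∑' n : ℤ, wpTerm q 0 b c d (z * q ^ n) = qPoch (b * c / q) q * qPoch (b * d / q) q *
      qPoch (c * d / q) q * ∑' n : ℤ, wpTerm q 0 0 0 0 (z * q ^ n) := by
  -- With one parameter already 0 the convergence condition is trivial, so b, c, d can be sent to 0
  -- one after another.
  have h1 := tsum_wpTerm_reduce hq hq0 hz hzq (a := b) (b := 0) (c := c) (d := d) (by simp)
  have h2 := tsum_wpTerm_reduce hq hq0 hz hzq (a := c) (b := 0) (c := 0) (d := d) (by simp)
  have h3 := tsum_wpTerm_reduce hq hq0 hz hzq (a := d) (b := 0) (c := 0) (d := 0) (by simp)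
  simp only [mul_zero, zero_mul, zero_div, qPoch_zero, one_mul] at h1 h2 h3
  simp only [wpTerm_swap_left 0 b, h1]
  simp only [wpTerm_swap_left_third 0 0 c d, h2]
  simp only [wpTerm_swap_left_fourth 0 0 0 d, h3]
  ring

/-- Bailey's bilateral sum of a very-well-poised `₆ψ₆` series. -/
theorem tsum_wpTerm (hq : ‖q‖ < 1) (hq0 : q ≠ 0) {z : ℂ} (hz : z ≠ 0)
    (hzq : ∀ k : ℤ, z ^ 2 ≠ q ^ k) {a b c d : ℂ} (h : ‖a * b * c * d / q ^ 3‖ < 1) :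
    ∑' n : ℤ, wpTerm q a b c d (z * q ^ n) =
      qPoch q q * qPoch (a * b / q) q * qPoch (a * c / q) q * qPoch (a * d / q) q *
        qPoch (b * c / q) q * qPoch (b * d / q) q * qPoch (c * d / q) q /
        qPoch (a * b * c * d / q ^ 3) q := by
  have hqq : qPoch q q ≠ 0 := qPoch_ne_zero_of_norm_lt_one hq hq
  have h0 : ∑' n : ℤ, wpTerm q 0 0 0 0 (z * q ^ n) = qPoch q q := by
    -- As z is fixed, the parameters may depend on it. Here ab/q = q, so the relation reads (q;q)_∞²
    -- = (q;q)_∞ · C with C the required constant, whence C does not depend on z.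
    have h1 := tsum_wpTerm_reduce hq hq0 hz hzq (a := q / z) (b := q * z) (c := 0) (d := 0)
      (by simp)
    rw [tsum_wpTerm_terminating hq hq0 hz hzq, tsum_wpTerm_zero_left hq hq0 hz hzq] at h1
    simp only [mul_zero, zero_div, qPoch_zero, one_mul, mul_one] at h1
    rw [show q / z * (q * z) / q = q by field_simp, sq] at h1
    exact (mul_left_cancel₀ hqq h1).symm
  rw [eq_div_iff (qPoch_ne_zero_of_norm_lt_one hq h), mul_comm,
    tsum_wpTerm_reduce hq hq0 hz hzq h, tsum_wpTerm_zero_left hq hq0 hz hzq, h0]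
  ring

end BilateralSumValue

/-! ### Unfolding an integral over ℝ into one over a period. -/

section Unfolding

/-- Unfolding an integral over `ℝ` against a `1`-periodic function. -/
lemma integral_mul_periodic_of_tsum {K p : ℝ → ℂ} (hK : Continuous K) {g : ℤ → ℝ} (hg : Summable g)
    (hb : ∀ x ∈ Set.Icc (0 : ℝ) 1, ∀ n : ℤ, ‖K (x + n)‖ ≤ g n) (hp : Function.Periodic p 1)
    (hpi : IntervalIntegrable p volume 0 1) {S : ℂ}
    (hS : ∀ x ∈ Set.Icc (0 : ℝ) 1, ∑' n : ℤ, K (x + n) = S) :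
    Integrable (fun x => K x * p x) ∧ ∫ x, K x * p x = S * ∫ x in (0 : ℝ)..1, p x := by
  have hpn : ∀ (n : ℤ) (x : ℝ), p (x + n) = p x := fun n x => by
    simpa using hp.int_mul n x
  have hg0 : ∀ n, 0 ≤ g n := fun n => (norm_nonneg _).trans (hb 0 (by simp) n)
  have hloc : ∀ n : ℤ, IntervalIntegrable (fun x => K x * p x) volume n (n + 1) := fun n =>
    (hp.intervalIntegrable₀ one_ne_zero hpi n (n + 1)).continuousOn_mul hK.continuousOn
  have hshift : ∀ n : ℤ, IntervalIntegrable (fun x => K (x + n) * p x) volume 0 1 := fun n =>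
    hpi.continuousOn_mul (by fun_prop)
  have hint : Integrable (fun x => K x * p x) := by
    rw [← integrableOn_univ, ← iUnion_Ioc_add_intCast (0 : ℝ)]
    -- The integral of the norm over [n, n+1] is at most g(n) ∫₀¹|p|, which is summable.
    refine integrableOn_iUnion_of_summable_integral_norm (fun n => ?_) ?_
    · rw [zero_add, ← intervalIntegrable_iff_integrableOn_Ioc_of_le (by simp)]
      exact hloc n
    · refine Summable.of_nonneg_of_le (fun n => by positivity) (fun n => ?_)
        (hg.mul_right (∫ x in (0 : ℝ)..1, ‖p x‖))
      rw [zero_add, ← intervalIntegral.integral_of_le (by simp)]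
      have h1 := intervalIntegral.integral_comp_add_right (a := 0) (b := 1)
        (fun x => ‖K x * p x‖) (n : ℝ)
      rw [zero_add, add_comm (1 : ℝ)] at h1
      rw [← h1, ← intervalIntegral.integral_const_mul]
      refine intervalIntegral.integral_mono_on zero_le_one ?_ (hpi.norm.const_mul _) fun x hx => ?_
      · simpa only [hpn] using (hshift n).norm
      · rw [hpn, norm_mul]
        exact mul_le_mul_of_nonneg_right (hb x hx n) (norm_nonneg _)
  refine ⟨hint, ?_⟩
  have h1 := hint.hasSum_intervalIntegral_comp_add_int
  have hIoc : Set.uIoc (0 : ℝ) 1 ⊆ Set.Icc 0 1 := by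
    rw [Set.uIoc_of_le zero_le_one]; exact Set.Ioc_subset_Icc_self
  have h2 : HasSum (fun n : ℤ => ∫ x in (0 : ℝ)..1, K (x + n) * p (x + n))
      (∫ x in (0 : ℝ)..1, S * p x) := by
    simp only [hpn]
    refine intervalIntegral.hasSum_integral_of_dominated_convergence
      (fun n x => g n * ‖p x‖) (fun n => ?_) (fun n => ?_) ?_ ?_ ?_
    · exact (intervalIntegrable_iff.mp (hshift n)).aestronglyMeasurable
    · refine Eventually.of_forall fun x hx => ?_
      rw [norm_mul]
      exact mul_le_mul_of_nonneg_right (hb x (hIoc hx) n) (norm_nonneg _)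
    · exact Eventually.of_forall fun x _ => hg.mul_right _
    · simp only [tsum_mul_right]
      exact hpi.norm.const_mul _
    · refine Eventually.of_forall fun x hx => ?_
      rw [← hS x (hIoc hx)]
      exact (Summable.of_norm_bounded hg (hb x (hIoc hx))).hasSum.mul_right _
  rw [h1.unique h2, intervalIntegral.integral_const_mul]

end Unfolding

/-! ### The integral against a periodic function. -/

section BaileyIntegral

variable {q : ℝ}

lemma baileyKernel_eq_wpTerm (hq0 : 0 < q) (α a b c d : ℂ) (x : ℝ) :
    baileyKernel q α a b c d x = wpTerm q a b c d (α * (q ^ x : ℝ)) := by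
  have hneg : ((q ^ (-x) : ℝ) : ℂ) = ((q ^ x : ℝ) : ℂ)⁻¹ := by
    rw [Real.rpow_neg hq0.le, Complex.ofReal_inv]
  have h1 : ((q ^ (2 * x + 1) : ℝ) : ℂ) = q * ((q ^ x : ℝ) : ℂ) ^ 2 := by
    rw [Real.rpow_add hq0, Real.rpow_one, mul_comm 2 x, Real.rpow_mul hq0.le]
    push_cast
    norm_num
    ring
  have h2 : ((q ^ (1 - 2 * x) : ℝ) : ℂ) = q / ((q ^ x : ℝ) : ℂ) ^ 2 := by
    rw [Real.rpow_sub hq0, Real.rpow_one, mul_comm 2 x, Real.rpow_mul hq0.le]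
    push_cast
    norm_num
  have hD1 : α ^ 2 * (q * ((q ^ x : ℝ) : ℂ) ^ 2) = q * (α * (q ^ x : ℝ)) ^ 2 := by ring
  have hD2 : (q : ℂ) / ((q ^ x : ℝ) : ℂ) ^ 2 / α ^ 2 = q / (α * (q ^ x : ℝ)) ^ 2 := by
    rw [div_div, mul_pow, mul_comm]
  have hN1 : ∀ e : ℂ, α * e * (q ^ x : ℝ) = e * (α * (q ^ x : ℝ)) := fun e => by ring
  have hN2 : ∀ e : ℂ, e * ((q ^ x : ℝ) : ℂ)⁻¹ / α = e / (α * (q ^ x : ℝ)) := fun e => by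
    rw [← div_eq_mul_inv, div_div, mul_comm α]
  simp only [baileyKernel, wpTerm, qPochs, List.map_cons, List.map_nil, List.prod_cons,
    List.prod_nil, hneg, h1, h2, hD1, hD2, hN1, hN2]
  ring

/-- Equality would make α² = q^k/q^{2x} a positive real, of argument 0. Thus the denominator never
vanishes on the real line. -/
lemma sq_ne_zpow_of_arg (hq0 : 0 < q) {α : ℂ} (hα : Complex.arg (α ^ 2) ≠ 0) (x : ℝ) (k : ℤ) :
    (α * (q ^ x : ℝ)) ^ 2 ≠ (q : ℂ) ^ k := by
  intro h
  have hx : 0 < q ^ x := Real.rpow_pos_of_pos hq0 x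
  refine hα ?_
  have h1 : α ^ 2 = ((q ^ k / (q ^ x) ^ 2 : ℝ) : ℂ) := by
    have hne : ((q ^ x : ℝ) : ℂ) ≠ 0 := Complex.ofReal_ne_zero.mpr hx.ne'
    rw [Complex.ofReal_div, Complex.ofReal_zpow, Complex.ofReal_pow, ← h, eq_div_iff (by positivity)]
    ring
  rw [h1]
  exact Complex.arg_ofReal_of_nonneg (by positivity)

lemma continuous_modTheta {q : ℂ} (hq : ‖q‖ < 1) {X : Type*} [TopologicalSpace X] {f : X → ℂ}
    (hf : Continuous f) (h0 : ∀ x, f x ≠ 0) : Continuous fun x => modTheta q (f x) := by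
  have := continuous_qPoch hq
  simp only [modTheta]
  exact (this.comp hf).mul (this.comp (continuous_const.div hf h0))

theorem bailey_integral (hq0 : 0 < q) (hq1 : q < 1) {a b c d α : ℂ}
    (habcd : ‖a * b * c * d / (q : ℂ) ^ 3‖ < 1) (hα0 : α ≠ 0) (hα : Complex.arg (α ^ 2) ≠ 0)
    {p : ℝ → ℂ} (hp : Function.Periodic p 1) (hpi : IntervalIntegrable p volume 0 1) :
    Integrable (fun x : ℝ => baileyKernel q α a b c d x * p x) ∧
      ∫ x : ℝ, baileyKernel q α a b c d x * p x =
        baileyValue q a b c d * ∫ x in (0 : ℝ)..1, p x := by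
  have hqn : ‖(q : ℂ)‖ < 1 := by rwa [Complex.norm_real, Real.norm_of_nonneg hq0.le]
  have hqne : (q : ℂ) ≠ 0 := Complex.ofReal_ne_zero.mpr hq0.ne'
  set z : ℝ → ℂ := fun x => α * (q ^ x : ℝ) with hz
  have hz0 : ∀ x, z x ≠ 0 := fun x =>
    mul_ne_zero hα0 (Complex.ofReal_ne_zero.mpr (Real.rpow_pos_of_pos hq0 x).ne')
  have hzq : ∀ x, ∀ k : ℤ, z x ^ 2 ≠ (q : ℂ) ^ k := fun x k => sq_ne_zpow_of_arg hq0 hα x k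
  have hzq' : ∀ x, ∀ k : ℤ, (z x)⁻¹ ^ 2 ≠ (q : ℂ) ^ k := fun x k h =>
    hzq x (-k) (by rw [zpow_neg, ← h, inv_pow, inv_inv])
  have hzc : Continuous z := continuous_const.mul
    (Complex.continuous_ofReal.comp (continuous_const.rpow continuous_id fun x => Or.inl hq0.ne'))
  have hzc' : Continuous fun x => (z x)⁻¹ := hzc.inv₀ hz0
  have hzn : ∀ x (n : ℤ), z (x + n) = z x * (q : ℂ) ^ n := fun x n => by
    simp only [hz]
    rw [Real.rpow_add_intCast hq0.ne']
    push_cast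
    ring
  have hθ : Continuous fun x => (modTheta (q : ℂ) (z x ^ 2))⁻¹ :=
    (continuous_modTheta hqn (hzc.pow 2) fun x => pow_ne_zero 2 (hz0 x)).inv₀ fun x =>
      modTheta_ne_zero hqn hqne (pow_ne_zero 2 (hz0 x)) (hzq x)
  have hθ' : Continuous fun x => (modTheta (q : ℂ) ((z x)⁻¹ ^ 2))⁻¹ :=
    (continuous_modTheta hqn (hzc'.pow 2) fun x => pow_ne_zero 2 (inv_ne_zero (hz0 x))).inv₀
      fun x => modTheta_ne_zero hqn hqne (pow_ne_zero 2 (inv_ne_zero (hz0 x))) (hzq' x)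
  -- Compactness of [0,1] bounds z, 1/z and the two inverse thetas uniformly, so a single majorant
  -- in n works for all x in the period.
  obtain ⟨R₁, hR₁⟩ := (isCompact_Icc (a := (0 : ℝ)) (b := 1)).exists_bound_of_continuousOn
    hzc.continuousOn
  obtain ⟨R₂, hR₂⟩ := (isCompact_Icc (a := (0 : ℝ)) (b := 1)).exists_bound_of_continuousOn
    hzc'.continuousOn
  obtain ⟨T₁, hT₁⟩ := (isCompact_Icc (a := (0 : ℝ)) (b := 1)).exists_bound_of_continuousOn
    hθ.continuousOn
  obtain ⟨T₂, hT₂⟩ := (isCompact_Icc (a := (0 : ℝ)) (b := 1)).exists_bound_of_continuousOn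
    hθ'.continuousOn
  have hR0 : 0 ≤ max R₁ R₂ := (norm_nonneg _).trans ((hR₁ 0 (by simp)).trans (le_max_left _ _))
  have hker : baileyKernel q α a b c d = fun x => wpTerm q a b c d (z x) :=
    funext (baileyKernel_eq_wpTerm hq0 α a b c d)
  rw [hker]
  refine integral_mul_periodic_of_tsum ?_
    ((summable_wpMajorant_natAbs (norm_pos_iff.mpr hqne) hqn hR0 (norm_nonneg a) (norm_nonneg b)
      (norm_nonneg c) (norm_nonneg d) (by simpa using habcd)).mul_left
      (wpConst ‖(q : ℂ)‖ (max R₁ R₂) (max T₁ T₂) ‖a‖ ‖b‖ ‖c‖ ‖d‖)) (fun x hx n => ?_) hp hpi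
    fun x _ => ?_
  · have hP := continuous_qPoch hqn
    have h1 : ∀ e : ℂ, Continuous fun x => qPoch (e * z x) q := fun e =>
      hP.comp (continuous_const.mul hzc)
    have h2 : ∀ e : ℂ, Continuous fun x => qPoch (e / z x) q := fun e =>
      hP.comp (continuous_const.div hzc hz0)
    have h3 : Continuous fun x => qPoch (q * z x ^ 2) q * qPoch (q / z x ^ 2) q :=
      (hP.comp (continuous_const.mul (hzc.pow 2))).mul
        (hP.comp (continuous_const.div (hzc.pow 2) fun x => pow_ne_zero 2 (hz0 x)))
    have h4 : ∀ x, qPoch (q * z x ^ 2) q * qPoch (q / z x ^ 2) q ≠ 0 := fun x => by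
      have := modTheta_ne_zero hqn hqne (pow_ne_zero 2 (hz0 x)) (hzq x)
      rw [modTheta_eq hqn] at this
      exact right_ne_zero_of_mul this
    exact (((((h1 a).mul (h2 a)).mul ((h1 b).mul (h2 b))).mul ((h1 c).mul (h2 c))).mul
      ((h1 d).mul (h2 d))).div h3 h4
  · rw [hzn]
    exact norm_wpTerm_mul_zpow_le hqn hqne (hz0 x) (hzq x) ((hR₁ x hx).trans (le_max_left _ _))
      ((hR₂ x hx).trans (le_max_right _ _)) ((hT₁ x hx).trans (le_max_left _ _))
      ((hT₂ x hx).trans (le_max_right _ _)) le_rfl le_rfl le_rfl le_rfl n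
  · simp only [hzn]
    rw [tsum_wpTerm hqn hqne (hz0 x) (hzq x) habcd, baileyValue]
    simp only [qPochs, List.map_cons, List.map_nil, List.prod_cons, List.prod_nil]
    ring

end BaileyIntegral

/-! ### Askey's integral as the case α = i. -/

section AskeyIntegral

/-- With 2x = w + 1/w each quadratic factor splits: 1 - 2axt + a²t² = (1 - awt)(1 - at/w). -/
lemma askeyH_eq_qPoch_mul {q : ℂ} (hq : ‖q‖ < 1) {x w : ℂ} (hw : w ≠ 0) (hx : 2 * x = w + w⁻¹)
    (a : ℂ) : askeyH q x a = qPoch (a * w) q * qPoch (a / w) q := by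
  rw [qPoch, qPoch, askeyH, ← (multipliable_one_sub_mul_pow hq _).tprod_mul
    (multipliable_one_sub_mul_pow hq _)]
  refine tprod_congr fun n => ?_
  rw [show 2 * a * x * q ^ n = a * (2 * x) * q ^ n by ring, hx]
  field_simp
  ring

lemma qPoch_mul_qPoch_neg {q : ℂ} (hq : ‖q‖ < 1) (x : ℂ) :
    qPoch x q * qPoch (-x) q = qPoch (x ^ 2) (q ^ 2) := by
  rw [qPoch, qPoch, qPoch, ← (multipliable_one_sub_mul_pow hq _).tprod_mul
    (multipliable_one_sub_mul_pow hq _)]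
  exact tprod_congr fun n => by ring

lemma qPoch_sq_mul_qPoch_sq {q : ℂ} (hq : ‖q‖ < 1) (x : ℂ) :
    qPoch x (q ^ 2) * qPoch (x * q) (q ^ 2) = qPoch x q := by
  have hq2 : ‖q ^ 2‖ < 1 := by
    rw [norm_pow]; exact pow_lt_one₀ (norm_nonneg _) hq two_ne_zero
  have h1 : (fun n : ℕ => 1 - x * (q ^ 2) ^ n) = fun n : ℕ => 1 - x * q ^ (2 * n) := by
    ext n; rw [pow_mul]
  have h2 : (fun n : ℕ => 1 - x * q * (q ^ 2) ^ n) = fun n : ℕ => 1 - x * q ^ (2 * n + 1) := by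
    ext n; ring
  have e := multipliable_one_sub_mul_pow hq2 x
  have o := multipliable_one_sub_mul_pow hq2 (x * q)
  rw [qPoch, qPoch, qPoch]
  rw [h1] at e ⊢
  rw [h2] at o ⊢
  exact tprod_even_mul_odd (f := fun n : ℕ => 1 - x * q ^ n) e o

/-- Pairing opposite signs gives (qy²; q²)_∞ (q²y²; q²)_∞, the even and odd factors of (qy²; q)_∞.
This collapses Askey's four-parameter denominator to the kernel's. -/
lemma qPoch_quadruple {q s : ℂ} (hq : ‖q‖ < 1) (hs : s ^ 2 = q) (y : ℂ) :
    qPoch (s * y) q * qPoch (-s * y) q * (qPoch (q * y) q * qPoch (-q * y) q) =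
      qPoch (q * y ^ 2) q := by
  rw [neg_mul, neg_mul, qPoch_mul_qPoch_neg hq, qPoch_mul_qPoch_neg hq,
    ← qPoch_sq_mul_qPoch_sq hq (q * y ^ 2), mul_pow, mul_pow, hs]
  ring_nf

lemma askey_integrand_eq {q : ℝ} (hq0 : 0 < q) (hq1 : q < 1) (a b c d : ℂ) (u : ℝ) :
    askeyHs q (Complex.I * Real.sinh u) [a, b, c, d] /
        askeyHs q (Complex.I * Real.sinh u)
          [(Real.sqrt q : ℂ), -(Real.sqrt q : ℂ), (q : ℂ), -(q : ℂ)] =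
      baileyKernel q Complex.I a b c d (u / Real.log q) := by
  have hqn : ‖(q : ℂ)‖ < 1 := by rwa [Complex.norm_real, Real.norm_of_nonneg hq0.le]
  have hlog : Real.log q ≠ 0 := (Real.log_neg hq0 hq1).ne
  have hexp : q ^ (u / Real.log q) = Real.exp u := by
    rw [Real.rpow_def_of_pos hq0, mul_div_cancel₀ _ hlog]
  have hs : (Real.sqrt q : ℂ) ^ 2 = q := by
    rw [← Complex.ofReal_pow, Real.sq_sqrt hq0.le]
  rw [baileyKernel_eq_wpTerm hq0, hexp]
  -- For w = ie^u one has 1/w = -ie^{-u}, hence w + 1/w = 2i sinh u.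
  set w : ℂ := Complex.I * (Real.exp u : ℝ) with hwdef
  have hw : w ≠ 0 := mul_ne_zero Complex.I_ne_zero (Complex.ofReal_ne_zero.mpr (Real.exp_ne_zero u))
  have hx : 2 * (Complex.I * (Real.sinh u : ℂ)) = w + w⁻¹ := by
    rw [hwdef, mul_inv, Complex.inv_I, Real.sinh_eq, Real.exp_neg]
    push_cast
    ring
  simp only [askeyHs, List.map_cons, List.map_nil, List.prod_cons, List.prod_nil,
    askeyH_eq_qPoch_mul hqn hw hx, wpTerm]
  have h1 := qPoch_quadruple hqn hs w
  have h2 := qPoch_quadruple hqn hs w⁻¹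
  rw [inv_pow] at h2
  simp only [← div_eq_mul_inv] at h2
  rw [← h1, ← h2]
  ring

theorem askey_integral {q : ℝ} (hq0 : 0 < q) (hq1 : q < 1) {a b c d : ℂ}
    (habcd : ‖a * b * c * d / (q : ℂ) ^ 3‖ < 1) :
    Integrable (fun u : ℝ =>
        askeyHs q (Complex.I * Real.sinh u) [a, b, c, d] /
          askeyHs q (Complex.I * Real.sinh u)
            [(Real.sqrt q : ℂ), -(Real.sqrt q : ℂ), (q : ℂ), -(q : ℂ)]) ∧
      ∫ u : ℝ,
        askeyHs q (Complex.I * Real.sinh u) [a, b, c, d] /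
          askeyHs q (Complex.I * Real.sinh u)
            [(Real.sqrt q : ℂ), -(Real.sqrt q : ℂ), (q : ℂ), -(q : ℂ)] =
        (Real.log q⁻¹ : ℂ) * baileyValue q a b c d := by
  have hlog := Real.log_neg hq0 hq1
  have hI : Complex.arg (Complex.I ^ 2) ≠ 0 := by
    rw [Complex.I_sq, Complex.arg_neg_one]; exact Real.pi_ne_zero
  obtain ⟨hi, hv⟩ := bailey_integral hq0 hq1 habcd Complex.I_ne_zero hI (p := fun _ => 1)
    (fun _ => rfl) intervalIntegrable_const
  simp only [mul_one, intervalIntegral.integral_const, sub_zero, one_smul] at hi hv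
  simp only [askey_integrand_eq hq0 hq1]
  refine ⟨hi.comp_div hlog.ne, ?_⟩
  -- The dilation x = u / log q contributes |log q| = log q⁻¹.
  rw [Measure.integral_comp_div, hv, abs_of_neg hlog, Real.log_inv, Complex.real_smul]

end AskeyIntegral

theorem mainTheorem1 (q : ℝ) (hq0 : 0 < q) (hq1 : q < 1) (a b c d : ℂ)
    (habcd : ‖a * b * c * d / (q : ℂ) ^ 3‖ < 1) :
    (∀ α : ℂ, α ≠ 0 → (∀ k : ℤ, Complex.arg (α ^ 2) ≠ 2 * k * Real.pi) →
      ∀ p : ℝ → ℂ, Function.Periodic p 1 → IntervalIntegrable p volume 0 1 →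
        Integrable (fun x : ℝ => baileyKernel q α a b c d x * p x) ∧
        ∫ x : ℝ, baileyKernel q α a b c d x * p x =
          baileyValue q a b c d * ∫ x in (0 : ℝ)..1, p x) ∧
    (Integrable (fun u : ℝ =>
        askeyHs q (Complex.I * Real.sinh u) [a, b, c, d] /
          askeyHs q (Complex.I * Real.sinh u)
            [(Real.sqrt q : ℂ), -(Real.sqrt q : ℂ), (q : ℂ), -(q : ℂ)]) ∧
      ∫ u : ℝ,
        askeyHs q (Complex.I * Real.sinh u) [a, b, c, d] /
          askeyHs q (Complex.I * Real.sinh u)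
            [(Real.sqrt q : ℂ), -(Real.sqrt q : ℂ), (q : ℂ), -(q : ℂ)] =
        (Real.log q⁻¹ : ℂ) * baileyValue q a b c d) := by
  refine ⟨fun α hα0 hα p hp hpi => bailey_integral hq0 hq1 habcd hα0 ?_ hp hpi,
    askey_integral hq0 hq1 habcd⟩
  -- The principal argument lies in (-π, π], so 0 is the only multiple of 2π it can equal.
  simpa using hα 0
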